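/- Let $d \ge 1$ be an integer and let $(\rho_n)_{n\in\mathbb N}$ be a sequence of radial mollifiers, that is, $\rho_n \in L^1_{\mathrm{loc}}(0,\infty)$, $\rho_n \ge 0$, $\int_0^\infty \rho_n(r) r^{d-1}\,dr = 1$ for all $n$, $\lim_{n\to\infty}\int_\delta^\infty \rho_n(r) r^{d-1}\,dr = 0$ for all $\delta>0$, and $\rho_n(r)=0$ for $r>1$ and all $n$. Let $u \in BV_{\mathrm{loc}}(\mathbb R^d)$, that is, $u \in L^1_{\mathrm{loc}}(\mathbb R^d)$ is real-valued and its distributional gradient $\nabla u$ is an $\mathbb R^d$-valued Radon measure. Denote by $\nabla^{ac}u$ (the density with respect to Lebesgue measure of) the absolutely continuous part of $\nabla u$. Then, for almost every $x \in \mathbb R^d$, $$\lim_{n\to\infty} \int_{\mathbb R^d} \frac{|u(x+h)-u(x)-\nabla^{ac}u(x)\cdot h|}{|h|}\,\rho_n(|h|)\,dh = 0.$$ Consequently, for almost every $x\in\mathbb R^d$, $$\lim_{n\to\infty} D_{n,1}(u)(x) = \gamma_{d,1}\,|\nabla^{ac}u(x)|,$$ where $$D_{n,1}(u)(x) = \int_{\mathbb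 R^d} \frac{|u(x)-u(y)|}{|x-y|}\,\rho_n(|x-y|)\,dy \in [0,\infty], \qquad \gamma_{d,1} = \int_{\mathbb S^{d-1}} |\sigma\cdot e|\,d\sigma$$ for any $e \in \mathbb S^{d-1}$, with $d\sigma$ the surface measure on $\mathbb S^{d-1}$ (the counting measure if $d=1$). -/

import Mathlib

open MeasureTheory Set Filter
open scoped Topology ENNReal ContDiff

/-- Sequences of radial mollifiers on `ℝ^d`: nonnegative functions `ρ n ∈ L¹_loc(0, ∞)`, of mass one
for `r ^ (d - 1) dr`, which concentrate at the origin and vanish for `r > 1`. As usual for elements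
of `L¹_loc`, pointwise conditions are required almost everywhere. -/
structure IsRadialMollifierSeq (d : ℕ) (ρ : ℕ → ℝ → ℝ) : Prop where
  locallyIntegrable : ∀ n, LocallyIntegrableOn (ρ n) (Ioi 0) volume
  nonneg : ∀ n, ∀ᵐ r ∂(volume.restrict (Ioi (0 : ℝ))), 0 ≤ ρ n r
  integral_eq_one : ∀ n, ∫ r in Ioi (0 : ℝ), ρ n r * r ^ (d - 1) = 1
  tendsto_tail : ∀ δ : ℝ, 0 < δ →
    Tendsto (fun n => ∫ r in Ioi δ, ρ n r * r ^ (d - 1)) atTop (𝓝 0)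
  eq_zero : ∀ n, ∀ᵐ r ∂(volume.restrict (Ioi (1 : ℝ))), ρ n r = 0

/-- The distributional gradient of `u` is the `ℝ^d`-valued Radon measure `σ μ`, written in polar
form: `μ` is a Radon (i.e. locally finite Borel) measure, the total variation `|∇u|`, and `σ` is a
measurable field with `|σ| = 1` at `μ`-almost every point. -/
structure IsGradientMeasure {d : ℕ} (u : EuclideanSpace ℝ (Fin d) → ℝ)
    (μ : Measure (EuclideanSpace ℝ (Fin d)))
    (σ : EuclideanSpace ℝ (Fin d) → EuclideanSpace ℝ (Fin d)) : Prop where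
  locallyFinite : IsLocallyFiniteMeasure μ
  measurable : Measurable σ
  norm_eq_one : ∀ᵐ x ∂μ, ‖σ x‖ = 1
  integral_eq : ∀ φ : EuclideanSpace ℝ (Fin d) → ℝ, ContDiff ℝ ∞ φ → HasCompactSupport φ →
    ∀ v : EuclideanSpace ℝ (Fin d),
      ∫ x, u x * fderiv ℝ φ x v = -∫ x, φ x * inner ℝ (σ x) v ∂μ

/-- `u ∈ BV_loc(ℝ^d)`: `u ∈ L¹_loc(ℝ^d)` and its distributional gradient is an `ℝ^d`-valued Radon
measure. -/
def MemBVloc {d : ℕ} (u : EuclideanSpace ℝ (Fin d) → ℝ) : Prop :=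
  LocallyIntegrable u volume ∧ ∃ μ σ, IsGradientMeasure u μ σ

/-- `g` is a representative of `∇^{ac} u`, the Lebesgue density of the absolutely continuous part
of the gradient measure: if `∇u = σ μ`, then the absolutely continuous part of `∇u` is
`σ (dμ/dx) dx`. -/
def IsACGradient {d : ℕ} (u : EuclideanSpace ℝ (Fin d) → ℝ)
    (g : EuclideanSpace ℝ (Fin d) → EuclideanSpace ℝ (Fin d)) : Prop :=
  ∃ μ σ, IsGradientMeasure u μ σ ∧
    ∀ᵐ x ∂(volume : Measure (EuclideanSpace ℝ (Fin d))),
      g x = (μ.rnDeriv volume x).toReal • σ x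

theorem MemBVloc.exists_isACGradient {d : ℕ} {u : EuclideanSpace ℝ (Fin d) → ℝ}
    (hu : MemBVloc u) : ∃ g, IsACGradient u g := by
  obtain ⟨_, μ, σ, h⟩ := hu
  exact ⟨fun x => (μ.rnDeriv volume x).toReal • σ x, μ, σ, h, Filter.Eventually.of_forall fun _ => rfl⟩

/-- `D_{n,1}(u)(x) = ∫ |u(x) - u(y)| / |x - y| ρ_n(|x - y|) dy ∈ [0, ∞]`, for `r = ρ_n`. -/
noncomputable def nonlocalD {d : ℕ} (r : ℝ → ℝ) (u : EuclideanSpace ℝ (Fin d) → ℝ)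
    (x : EuclideanSpace ℝ (Fin d)) : ℝ≥0∞ :=
  ∫⁻ y, ENNReal.ofReal (|u x - u y| / ‖x - y‖ * r ‖x - y‖)

/-- `∫_{S^{d-1}} |σ · e| dσ`, which is `γ_{d,1}` for every unit vector `e`; `dσ` is the surface
measure, i.e. the counting measure for `d = 1`. -/
noncomputable def gammaOne {d : ℕ} (e : EuclideanSpace ℝ (Fin d)) : ℝ :=
  ∫ s : Metric.sphere (0 : EuclideanSpace ℝ (Fin d)) 1, |inner ℝ (s : EuclideanSpace ℝ (Fin d)) e|
    ∂((volume : Measure (EuclideanSpace ℝ (Fin d))).toSphere)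

/-! Fix `x`, put `a = ∇^{ac}u(x)`, and let `ν` be the total variation of `∇u - a dx`
(`gradientDefect`). At almost every `x` this measure has density zero: the singular part of `∇u` has
zero density almost everywhere, and almost every point is a Lebesgue point of `∇^{ac}u`. Hence
`ν(B_t(x)) ≤ η t^d` for small `t`, with `η` arbitrarily small, and `ν(B_t(x)) ≤ K t^d` for `t ≤ 2`
with some finite `K`.

For a smooth `U`, `|U(rs) - U(0)|` is at most the integral of `|∇U|` along the ray. Cutting the ray
into dyadic shells turns growth `∫_{B_s} |∇U| ≤ B s^d` into a bound `2^d B` for the difference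
quotient integrated over the sphere (`lintegral_Ioo_lintegral_sphere_le`). This applies to `U(k) =
V(x + k) - a · k`, where `V` is a mollification of `u`: `|∇V - a|` is at most the mollified `ν`,
whose growth constant exceeds that of `ν` by at most `4^d`, whatever the mollification scale.
Fatou's lemma then passes from `V` to `u`.

Integration against `ρ_n(r) r^{d-1}` gives at most `8^d (η + K · tail_n(δ))`, and the tail vanishes
as `n → ∞`. The second limit follows by the triangle inequality, since polar coordinates evaluate
the linear part exactly, for every `n`, as `γ_{d,1} |a|`. -/

theorem enorm_sub_le_lintegral_enorm_fderiv {E : Type*} [NormedAddCommGroup E]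
    [NormedSpace ℝ E] {U : E → ℝ} (hU : ContDiff ℝ 1 U) {v : E}
    (hv : ‖v‖ = 1) {r : ℝ} (hr : 0 < r) :
    ‖U (r • v) - U 0‖ₑ ≤ ∫⁻ t in Ioo 0 r, ‖fderiv ℝ U (t • v)‖ₑ := by
  have hd : ∀ t ∈ uIcc 0 r, HasDerivAt (fun t : ℝ => U (t • v)) (fderiv ℝ U (t • v) v) t := by
    intro t _
    have h1 : HasDerivAt (fun t : ℝ => t • v) v t := by
      simpa using (hasDerivAt_id t).smul_const v
    exact ((hU.differentiable one_ne_zero).differentiableAt.hasFDerivAt).comp_hasDerivAt t h1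
  have hc : Continuous fun t : ℝ => fderiv ℝ U (t • v) v := by
    have := hU.continuous_fderiv one_ne_zero
    fun_prop
  have h := intervalIntegral.integral_eq_sub_of_hasDerivAt hd (hc.intervalIntegrable _ _)
  rw [zero_smul] at h
  rw [← h, intervalIntegral.integral_of_le hr.le, integral_Ioc_eq_integral_Ioo]
  refine (enorm_integral_le_lintegral_enorm _).trans (lintegral_mono fun t => ?_)
  have := (fderiv ℝ U (t • v)).le_opNorm v
  rw [hv, mul_one] at this
  exact enorm_le_iff_norm_le.2 this

/-! ### Polar coordinates and radial averages of difference quotients -/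

section Polar

variable {E : Type*} [NormedAddCommGroup E] [NormedSpace ℝ E] [FiniteDimensional ℝ E]
  [MeasurableSpace E] [BorelSpace E]

/-- Integration in polar coordinates for nonnegative functions. -/
theorem lintegral_eq_lintegral_lintegral_sphere [Nontrivial E] (μ : Measure E) [μ.IsAddHaarMeasure]
    {F : E → ℝ≥0∞} (hF : Measurable F) :
    ∫⁻ x, F x ∂μ = ∫⁻ r in Ioi (0 : ℝ), ENNReal.ofReal (r ^ (Module.finrank ℝ E - 1)) *
      ∫⁻ s : Metric.sphere (0 : E) 1, F (r • (s : E)) ∂μ.toSphere := by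
  have hG : Measurable fun p : Metric.sphere (0 : E) 1 × Ioi (0 : ℝ) =>
      F ((p.2 : ℝ) • (p.1 : E)) := by fun_prop
  calc ∫⁻ x, F x ∂μ = ∫⁻ x : ({(0)}ᶜ : Set E), F x.1 ∂(μ.comap (↑)) := by
        rw [lintegral_subtype_comap (measurableSet_singleton _).compl,
          restrict_compl_singleton]
    _ = ∫⁻ p, F ((p.2 : ℝ) • (p.1 : E))
          ∂(μ.toSphere.prod (.volumeIoiPow (Module.finrank ℝ E - 1))) := by
        rw [← μ.measurePreserving_homeomorphUnitSphereProd.lintegral_comp hG]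
        refine lintegral_congr fun x => ?_
        have hx : ‖(x : E)‖ ≠ 0 := norm_ne_zero_iff.2 x.2
        simp [smul_smul, mul_inv_cancel₀ hx]
    _ = _ := by
        rw [lintegral_prod_symm _ hG.aemeasurable, Measure.volumeIoiPow,
          lintegral_withDensity_eq_lintegral_mul _ (by fun_prop) hG.lintegral_prod_left']
        simp only [Pi.mul_apply]
        rw [lintegral_subtype_comap measurableSet_Ioi fun r : ℝ =>
          ENNReal.ofReal (r ^ (Module.finrank ℝ E - 1)) *
            ∫⁻ s : Metric.sphere (0 : E) 1, F (r • (s : E)) ∂μ.toSphere]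

theorem setLIntegral_mul_lintegral_sphere_le [Nontrivial E] (μ : Measure E) [μ.IsAddHaarMeasure]
    {f : E → ℝ≥0∞} (hf : Measurable f) {R : ℝ} {S : Set ℝ} (hS : S ⊆ Ioc 0 R) :
    ∫⁻ r in S, ENNReal.ofReal (r ^ (Module.finrank ℝ E - 1)) *
      ∫⁻ s : Metric.sphere (0 : E) 1, f (r • (s : E)) ∂μ.toSphere ≤
    ∫⁻ x in Metric.closedBall 0 R, f x ∂μ := by
  rw [← lintegral_indicator Metric.isClosed_closedBall.measurableSet,
    lintegral_eq_lintegral_lintegral_sphere μ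
      (hf.indicator Metric.isClosed_closedBall.measurableSet)]
  have h : ∀ r ∈ Ioc 0 R, ENNReal.ofReal (r ^ (Module.finrank ℝ E - 1)) *
      ∫⁻ s : Metric.sphere (0 : E) 1, f (r • (s : E)) ∂μ.toSphere =
      ENNReal.ofReal (r ^ (Module.finrank ℝ E - 1)) * ∫⁻ s : Metric.sphere (0 : E) 1,
        (Metric.closedBall 0 R).indicator f (r • (s : E)) ∂μ.toSphere := by
    intro r hr
    congr 1
    refine lintegral_congr fun s => ?_
    rw [indicator_of_mem]
    simpa [norm_smul, abs_of_pos hr.1] using hr.2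
  refine (lintegral_mono_set hS).trans ?_
  rw [setLIntegral_congr_fun measurableSet_Ioc h]
  exact lintegral_mono_set Ioc_subset_Ioi_self

/-- Growth of order `s ^ d` of the integrals over balls bounds the integral along rays. -/
theorem lintegral_Ioo_lintegral_sphere_le [Nontrivial E] (μ : Measure E) [μ.IsAddHaarMeasure]
    {f : E → ℝ≥0∞} (hf : Measurable f) {r : ℝ} (hr : 0 < r) {K : ℝ≥0∞}
    (hK : ∀ s, 0 < s → s ≤ r →
      ∫⁻ x in Metric.closedBall 0 s, f x ∂μ ≤ K * ENNReal.ofReal (s ^ Module.finrank ℝ E)) :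
    ∫⁻ t in Ioo 0 r, ∫⁻ s : Metric.sphere (0 : E) 1, f (t • (s : E)) ∂μ.toSphere ≤
      2 ^ Module.finrank ℝ E * K * ENNReal.ofReal r := by
  set d := Module.finrank ℝ E with hd
  have hd0 : 0 < d := Module.finrank_pos
  set G : ℝ → ℝ≥0∞ := fun t => ∫⁻ s : Metric.sphere (0 : E) 1, f (t • (s : E)) ∂μ.toSphere
  -- On a dyadic shell the Jacobian `t ^ (d - 1)` is constant up to a factor `2 ^ (d - 1)`, so it
  -- can be inserted at that cost to recover a volume integral. The shell bounds are proportional to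
  -- the radii and sum geometrically.
  let I : ℕ → Set ℝ := fun k => Ioc ((1 / 2) ^ (k + 1) * r) ((1 / 2) ^ k * r)
  have hcover : Ioo 0 r ⊆ ⋃ k, I k := by
    intro t ht
    obtain ⟨k, hk1, hk2⟩ := exists_nat_pow_near_of_lt_one (x := t / r) (y := (1 / 2 : ℝ))
      (div_pos ht.1 hr) ((div_le_one hr).2 ht.2.le) (by norm_num) (by norm_num)
    exact mem_iUnion.2 ⟨k, (lt_div_iff₀ hr).1 hk1, (div_le_iff₀ hr).1 hk2⟩
  have hpow : ∀ k : ℕ, 0 < (1 / 2 : ℝ) ^ k * r := fun k => by positivity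
  have hI : ∀ k, ∫⁻ t in I k, G t ≤
      2 ^ (d - 1) * K * ENNReal.ofReal r * ENNReal.ofReal ((1 / 2) ^ k) := by
    intro k
    have h1 : ∀ t ∈ I k, G t ≤ (ENNReal.ofReal (((1 / 2) ^ (k + 1) * r) ^ (d - 1)))⁻¹ *
        (ENNReal.ofReal (t ^ (d - 1)) * G t) := by
      intro t ht
      have hc : ENNReal.ofReal (((1 / 2) ^ (k + 1) * r) ^ (d - 1)) ≠ 0 := by
        have := hpow (k + 1)
        simp only [ne_eq, ENNReal.ofReal_eq_zero, not_le]
        positivity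
      rw [← mul_assoc]
      refine le_mul_of_one_le_left (zero_le) ?_
      rw [← ENNReal.inv_mul_cancel hc ENNReal.ofReal_ne_top]
      gcongr
      exact ht.1.le
    have hpos := hpow (k + 1)
    calc ∫⁻ t in I k, G t
        ≤ ∫⁻ t in I k, (ENNReal.ofReal (((1 / 2) ^ (k + 1) * r) ^ (d - 1)))⁻¹ *
            (ENNReal.ofReal (t ^ (d - 1)) * G t) := setLIntegral_mono' measurableSet_Ioc h1
      _ = (ENNReal.ofReal (((1 / 2) ^ (k + 1) * r) ^ (d - 1)))⁻¹ *
            ∫⁻ t in I k, ENNReal.ofReal (t ^ (d - 1)) * G t :=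
          lintegral_const_mul' _ _ (by
            simp only [ne_eq, ENNReal.inv_eq_top, ENNReal.ofReal_eq_zero, not_le]
            positivity)
      _ ≤ (ENNReal.ofReal (((1 / 2) ^ (k + 1) * r) ^ (d - 1)))⁻¹ *
            (K * ENNReal.ofReal (((1 / 2) ^ k * r) ^ d)) := by
          gcongr
          refine (setLIntegral_mul_lintegral_sphere_le μ hf (R := (1 / 2) ^ k * r)
            (Ioc_subset_Ioc_left (hpow (k + 1)).le)).trans (hK _ (hpow k) ?_)
          exact mul_le_of_le_one_left hr.le (pow_le_one₀ (by norm_num) (by norm_num))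
      _ = _ := by
          rw [← ENNReal.ofReal_inv_of_pos (by positivity)]
          have h2 : (2 : ℝ≥0∞) ^ (d - 1) = ENNReal.ofReal (2 ^ (d - 1)) := by
            rw [ENNReal.ofReal_pow (by norm_num)]; simp
          rw [h2]
          have h3 : ENNReal.ofReal (((1 / 2) ^ (k + 1) * r) ^ (d - 1))⁻¹ *
              ENNReal.ofReal (((1 / 2) ^ k * r) ^ d) =
              ENNReal.ofReal (2 ^ (d - 1)) * ENNReal.ofReal r * ENNReal.ofReal ((1 / 2) ^ k) := by
            rw [← ENNReal.ofReal_mul (by positivity), ← ENNReal.ofReal_mul (by positivity),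
              ← ENNReal.ofReal_mul (by positivity)]
            congr 1
            obtain ⟨m, hm⟩ : ∃ m, d = m + 1 := ⟨d - 1, by omega⟩
            rw [hm, Nat.add_sub_cancel, pow_succ (1 / 2 : ℝ) k, mul_right_comm,
              mul_pow _ (1 / 2 : ℝ), pow_succ _ m]
            field_simp
            simp
          calc _ = K * (ENNReal.ofReal (((1 / 2) ^ (k + 1) * r) ^ (d - 1))⁻¹ *
              ENNReal.ofReal (((1 / 2) ^ k * r) ^ d)) := by ring
            _ = _ := by rw [h3]; ring
  calc ∫⁻ t in Ioo 0 r, G t ≤ ∫⁻ t in ⋃ k, I k, G t := lintegral_mono_set hcover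
    _ ≤ ∑' k, ∫⁻ t in I k, G t := lintegral_iUnion_le _ _
    _ ≤ ∑' k : ℕ, 2 ^ (d - 1) * K * ENNReal.ofReal r * ENNReal.ofReal ((1 / 2) ^ k) :=
        ENNReal.tsum_le_tsum hI
    _ = 2 ^ (d - 1) * K * ENNReal.ofReal r * 2 := by
        rw [ENNReal.tsum_mul_left, ← ENNReal.ofReal_tsum_of_nonneg (fun k => by positivity)
          summable_geometric_two, tsum_geometric_two]
        simp
    _ = _ := by
        obtain ⟨m, hm⟩ : ∃ m, d = m + 1 := ⟨d - 1, by omega⟩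
        rw [hm, Nat.add_sub_cancel]; ring

/-- The radial average of the difference quotients at `0` is controlled by the growth of the
integrals of the gradient over balls. -/
theorem lintegral_enorm_sub_div_mul_le [Nontrivial E] (μ : Measure E) [μ.IsAddHaarMeasure]
    {U : E → ℝ} (hU : ContDiff ℝ 1 U) {w : ℝ → ℝ≥0∞} (hw : Measurable w) {B : ℝ → ℝ≥0∞}
    (hB : ∀ r s, 0 < s → s ≤ r → ∫⁻ x in Metric.closedBall 0 s, ‖fderiv ℝ U x‖ₑ ∂μ ≤
      B r * ENNReal.ofReal (s ^ Module.finrank ℝ E)) :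
    ∫⁻ h, ‖U h - U 0‖ₑ / ‖h‖ₑ * w ‖h‖ ∂μ ≤
      ∫⁻ r in Ioi (0 : ℝ), ENNReal.ofReal (r ^ (Module.finrank ℝ E - 1)) *
        (2 ^ Module.finrank ℝ E * B r * w r) := by
  have hUc := hU.continuous
  have hfc := hU.continuous_fderiv one_ne_zero
  rw [lintegral_eq_lintegral_lintegral_sphere μ (by fun_prop)]
  refine setLIntegral_mono' measurableSet_Ioi fun r (hr : 0 < r) => ?_
  gcongr
  have hr0 : ENNReal.ofReal r ≠ 0 := by simpa using hr
  calc ∫⁻ s : Metric.sphere (0 : E) 1,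
        ‖U (r • (s : E)) - U 0‖ₑ / ‖r • (s : E)‖ₑ * w ‖r • (s : E)‖ ∂μ.toSphere
      ≤ ∫⁻ s : Metric.sphere (0 : E) 1, (ENNReal.ofReal r)⁻¹ * w r *
          (∫⁻ t in Ioo 0 r, ‖fderiv ℝ U (t • (s : E))‖ₑ) ∂μ.toSphere := by
        refine lintegral_mono fun s => ?_
        have hs : ‖(s : E)‖ = 1 := by simp
        have h1 : ‖r • (s : E)‖ₑ = ENNReal.ofReal r := by
          rw [← ofReal_norm, norm_smul, hs, mul_one, Real.norm_of_nonneg hr.le]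
        rw [h1, norm_smul, hs, mul_one, Real.norm_of_nonneg hr.le, div_eq_mul_inv,
          mul_assoc, mul_comm]
        gcongr
        exact enorm_sub_le_lintegral_enorm_fderiv hU hs hr
    _ = (ENNReal.ofReal r)⁻¹ * w r * ∫⁻ t in Ioo 0 r, ∫⁻ s : Metric.sphere (0 : E) 1,
          ‖fderiv ℝ U (t • (s : E))‖ₑ ∂μ.toSphere := by
        have hm : Measurable fun p : Metric.sphere (0 : E) 1 × ℝ =>
            ‖fderiv ℝ U (p.2 • (p.1 : E))‖ₑ := by
          refine Continuous.measurable ?_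
          fun_prop
        rw [lintegral_const_mul _ hm.lintegral_prod_right',
          lintegral_lintegral_swap hm.aemeasurable]
    _ ≤ (ENNReal.ofReal r)⁻¹ * w r * (2 ^ Module.finrank ℝ E * B r * ENNReal.ofReal r) := by
        gcongr
        exact lintegral_Ioo_lintegral_sphere_le μ hfc.enorm.measurable hr (hB r)
    _ = 2 ^ Module.finrank ℝ E * B r * w r * ((ENNReal.ofReal r)⁻¹ * ENNReal.ofReal r) := by ring
    _ = _ := by rw [ENNReal.inv_mul_cancel hr0 ENNReal.ofReal_ne_top, mul_one]

end Polar

/-! ### Growth of mollified measures on balls -/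

/-- Growth of order `t ^ d` survives mollification with a constant independent of the scale
`φ.rOut`. Two regimes occur, according to whether `s` is above or below that scale; the relevant
mass of `ν` lies in a ball of twice the larger of the two, hence the range `2 * R`. -/
theorem ContDiffBump.setLIntegral_closedBall_lintegral_normed_le {E : Type*}
    [NormedAddCommGroup E] [NormedSpace ℝ E] [FiniteDimensional ℝ E]
    [MeasurableSpace E] [BorelSpace E] [HasContDiffBump E] (μ : Measure E) [μ.IsAddHaarMeasure]
    (φ : ContDiffBump (0 : E)) (hφ : φ.rOut ≤ 2 * φ.rIn) (ν : Measure E) [SFinite ν] {x : E}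
    {R : ℝ} (hR : φ.rOut ≤ R) {K : ℝ≥0∞}
    (hν : ∀ t, 0 < t → t ≤ 2 * R →
      ν (Metric.closedBall x t) ≤ K * ENNReal.ofReal (t ^ Module.finrank ℝ E))
    {s : ℝ} (hs : 0 < s) (hsR : s ≤ R) :
    ∫⁻ y in Metric.closedBall x s, ∫⁻ z, ENNReal.ofReal (φ.normed μ (y - z)) ∂ν ∂μ ≤
      4 ^ Module.finrank ℝ E * K * ENNReal.ofReal (s ^ Module.finrank ℝ E) := by
  set d := Module.finrank ℝ E
  have hφc : Continuous (φ.normed μ) := φ.continuous_normed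
  have hφ0 : ∀ y, φ.rOut < ‖y‖ → φ.normed μ y = 0 := by
    intro y hy
    rw [← Function.notMem_support, φ.support_normed_eq]
    simpa using hy.le
  have hε := φ.rOut_pos
  have h2 : ∀ t : ℝ, 0 < t → ENNReal.ofReal ((2 * t) ^ d) = 2 ^ d * ENNReal.ofReal (t ^ d) := by
    intro t ht
    rw [mul_pow, ENNReal.ofReal_mul (by positivity), ENNReal.ofReal_pow (by norm_num)]
    simp
  rcases le_or_gt φ.rOut s with hεs | hεs
  -- Above the scale: by Tonelli, each `z` contributes at most the total mass one of the bump, and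
  -- only if it lies within `2 * s` of `x`.
  · rw [lintegral_lintegral_swap (by fun_prop)]
    have h1 : ∀ z, ∫⁻ y in Metric.closedBall x s, ENNReal.ofReal (φ.normed μ (y - z)) ∂μ ≤
        (Metric.closedBall x (2 * s)).indicator 1 z := by
      intro z
      by_cases hz : z ∈ Metric.closedBall x (2 * s)
      · rw [indicator_of_mem hz]
        calc _ ≤ ∫⁻ y, ENNReal.ofReal (φ.normed μ (y - z)) ∂μ := setLIntegral_le_lintegral _ _
          _ = ∫⁻ y, ENNReal.ofReal (φ.normed μ y) ∂μ :=
              lintegral_sub_right_eq_self (fun y => ENNReal.ofReal (φ.normed μ y)) z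
          _ = 1 := by
              rw [← ofReal_integral_eq_lintegral_ofReal φ.integrable_normed
                (Eventually.of_forall φ.nonneg_normed), φ.integral_normed, ENNReal.ofReal_one]
          _ ≤ _ := le_rfl
      · rw [indicator_of_notMem hz]
        refine (setLIntegral_congr_fun Metric.isClosed_closedBall.measurableSet
          (fun y hy => ?_)).trans_le (lintegral_zero (μ := μ.restrict _)).le
        rw [Metric.mem_closedBall, not_le] at hz
        rw [Metric.mem_closedBall] at hy
        rw [hφ0 (y - z), ENNReal.ofReal_zero]
        rw [← dist_eq_norm]
        linarith [dist_triangle z y x, dist_comm z y]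
    calc _ ≤ ∫⁻ z, (Metric.closedBall x (2 * s)).indicator 1 z ∂ν := lintegral_mono h1
      _ = ν (Metric.closedBall x (2 * s)) :=
          lintegral_indicator_one Metric.isClosed_closedBall.measurableSet
      _ ≤ K * ENNReal.ofReal ((2 * s) ^ d) := hν _ (by linarith) (by linarith)
      _ = 2 ^ d * K * ENNReal.ofReal (s ^ d) := by rw [h2 s hs]; ring
      _ ≤ _ := by gcongr; norm_num
  -- Below the scale: the bump is at most `2 ^ d` over the volume of its support ball, and the
  -- growth of `ν` at radius `2 * φ.rOut` gives another `2 ^ d`. The powers of `φ.rOut` cancel.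
  · have hB : μ.real (Metric.closedBall 0 φ.rOut) = φ.rOut ^ d * μ.real (Metric.ball 0 1) :=
      μ.addHaar_real_closedBall 0 hε.le
    have hb : 0 < μ.real (Metric.ball (0 : E) 1) :=
      ENNReal.toReal_pos (Metric.measure_ball_pos μ _ one_pos).ne' measure_ball_lt_top.ne
    set c : ℝ := 2 ^ d / μ.real (Metric.closedBall 0 φ.rOut) with hc
    have h1 : ∀ y ∈ Metric.closedBall x s, ∫⁻ z, ENNReal.ofReal (φ.normed μ (y - z)) ∂ν ≤
        ENNReal.ofReal c * (K * ENNReal.ofReal ((2 * φ.rOut) ^ d)) := by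
      intro y hy
      calc _ ≤ ∫⁻ z, (Metric.closedBall x (2 * φ.rOut)).indicator
                (fun _ => ENNReal.ofReal c) z ∂ν := by
            refine lintegral_mono fun z => ?_
            by_cases hz : z ∈ Metric.closedBall x (2 * φ.rOut)
            · rw [indicator_of_mem hz]
              exact ENNReal.ofReal_le_ofReal (φ.normed_le_div_measure_closedBall_rOut μ 2 hφ _)
            · rw [indicator_of_notMem hz]
              rw [Metric.mem_closedBall, not_le] at hz
              rw [Metric.mem_closedBall] at hy
              rw [hφ0 (y - z), ENNReal.ofReal_zero]
              rw [← dist_eq_norm]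
              linarith [dist_triangle z y x, dist_comm z y]
        _ = ENNReal.ofReal c * ν (Metric.closedBall x (2 * φ.rOut)) :=
            lintegral_indicator_const Metric.isClosed_closedBall.measurableSet _
        _ ≤ _ := by
            gcongr
            exact hν _ (by linarith) (by linarith)
    calc _ ≤ ∫⁻ _ in Metric.closedBall x s,
            ENNReal.ofReal c * (K * ENNReal.ofReal ((2 * φ.rOut) ^ d)) ∂μ :=
          setLIntegral_mono' Metric.isClosed_closedBall.measurableSet h1
      _ = ENNReal.ofReal c * (K * ENNReal.ofReal ((2 * φ.rOut) ^ d)) *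
            ENNReal.ofReal (s ^ d * μ.real (Metric.ball 0 1)) := by
          rw [lintegral_const, Measure.restrict_apply_univ, ← μ.addHaar_real_closedBall x hs.le,
            ofReal_measureReal measure_closedBall_lt_top.ne]
      _ = K * ENNReal.ofReal (c * (2 * φ.rOut) ^ d * (s ^ d * μ.real (Metric.ball 0 1))) := by
          rw [ENNReal.ofReal_mul (p := c * (2 * φ.rOut) ^ d) (by positivity),
            ENNReal.ofReal_mul (p := c) (by positivity)]
          ring
      _ = K * ENNReal.ofReal (4 ^ d * s ^ d) := by
          congr 2
          rw [hc, hB, mul_pow, show (4 : ℝ) = 2 * 2 by norm_num, mul_pow]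
          field_simp
      _ = _ := by
          rw [ENNReal.ofReal_mul (by positivity), ENNReal.ofReal_pow (by norm_num)]
          norm_num
          ring

/-- The total variation of `σ μ - a dx`, where `μ` is split into its singular and absolutely
continuous parts. -/
noncomputable def gradientDefect {d : ℕ} (μ : Measure (EuclideanSpace ℝ (Fin d)))
    (σ : EuclideanSpace ℝ (Fin d) → EuclideanSpace ℝ (Fin d)) (a : EuclideanSpace ℝ (Fin d)) :
    Measure (EuclideanSpace ℝ (Fin d)) :=
  μ.singularPart volume +
    volume.withDensity fun z => ‖(μ.rnDeriv volume z).toReal • σ z - a‖ₑ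

/-! ### Mollified gradients and the defect measure -/

section Defect

variable {d : ℕ} {u : EuclideanSpace ℝ (Fin d) → ℝ} {μ : Measure (EuclideanSpace ℝ (Fin d))}
    {σ : EuclideanSpace ℝ (Fin d) → EuclideanSpace ℝ (Fin d)}

/-- Integration by parts turns the left side into the pairing of `ψ` with the `v`-component of `σ μ
- a dx`. The Lebesgue decomposition of `μ` splits this into a singular piece, where `|σ| = 1`, and a
piece with density `(dμ/dx) σ - a`. -/
theorem IsGradientMeasure.enorm_integral_mul_fderiv_add_le (h : IsGradientMeasure u μ σ)
    {ψ : EuclideanSpace ℝ (Fin d) → ℝ} (hψ : ContDiff ℝ ∞ ψ) (hψc : HasCompactSupport ψ)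
    (hψ0 : ∀ z, 0 ≤ ψ z) (a v : EuclideanSpace ℝ (Fin d)) :
    ‖(∫ z, u z * fderiv ℝ ψ z v) + ∫ z, ψ z * inner ℝ a v‖ₑ ≤
      (∫⁻ z, ENNReal.ofReal (ψ z) ∂gradientDefect μ σ a) * ‖v‖ₑ := by
  have hlf := h.locallyFinite
  have hσ := h.measurable
  have hm : ∀ z, ‖ψ z‖ₑ = ENNReal.ofReal (ψ z) := fun z => Real.enorm_of_nonneg (hψ0 z)
  have hin : ∀ z w : EuclideanSpace ℝ (Fin d), ‖ψ z * inner ℝ w v‖ₑ ≤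
      ENNReal.ofReal (ψ z) * ‖w‖ₑ * ‖v‖ₑ := by
    intro z w
    rw [enorm_mul, hm, mul_assoc]
    gcongr
    rw [← ofReal_norm, ← ofReal_norm, ← ofReal_norm, ← ENNReal.ofReal_mul (norm_nonneg _)]
    exact ENNReal.ofReal_le_ofReal (norm_inner_le_norm w v)
  have hint : Integrable (fun z => ψ z * inner ℝ (σ z) v) μ := by
    have h1 : Integrable (fun z => ψ z * ‖v‖) μ :=
      (hψ.continuous.integrable_of_hasCompactSupport hψc).mul_const _
    refine h1.mono' ?_ ?_
    · exact (hψ.continuous.measurable.mul (hσ.inner measurable_const)).aestronglyMeasurable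
    · filter_upwards [h.norm_eq_one] with z hz
      rw [norm_mul, Real.norm_of_nonneg (hψ0 z)]
      gcongr
      · exact hψ0 z
      · simpa [hz] using norm_inner_le_norm (𝕜 := ℝ) (σ z) v
  have hdec : μ.singularPart volume + volume.withDensity (μ.rnDeriv volume) = μ :=
    Measure.singularPart_add_rnDeriv μ volume
  have hint1 : Integrable (fun z => ψ z * inner ℝ (σ z) v) (μ.singularPart volume) :=
    hint.mono_measure (Measure.singularPart_le _ _)
  have hint2 : Integrable (fun z => ψ z * inner ℝ (σ z) v)
      (volume.withDensity (μ.rnDeriv volume)) :=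
    hint.mono_measure (Measure.withDensity_rnDeriv_le _ _)
  have hint3 : Integrable (fun z => (μ.rnDeriv volume z).toReal • (ψ z * inner ℝ (σ z) v)) :=
    (integrable_withDensity_iff_integrable_smul' (Measure.measurable_rnDeriv _ _)
      (Measure.rnDeriv_lt_top _ _)).1 hint2
  have hint4 : Integrable (fun z => ψ z * inner ℝ a v) :=
    (hψ.continuous.integrable_of_hasCompactSupport hψc).mul_const _
  have hsplit : (∫ z, ψ z * inner ℝ (σ z) v ∂μ) - ∫ z, ψ z * inner ℝ a v =
      (∫ z, ψ z * inner ℝ (σ z) v ∂μ.singularPart volume) +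
        ∫ z, ψ z * inner ℝ ((μ.rnDeriv volume z).toReal • σ z - a) v := by
    conv_lhs => rw [← hdec]
    rw [integral_add_measure hint1 hint2, integral_withDensity_eq_integral_toReal_smul
      (Measure.measurable_rnDeriv _ _) (Measure.rnDeriv_lt_top _ _), add_sub_assoc,
      ← integral_sub hint3 hint4]
    congr 1
    refine integral_congr_ae (Eventually.of_forall fun z => ?_)
    simp only [smul_eq_mul, inner_sub_left, inner_smul_left]
    simp
    ring
  have hn1 : ∀ᵐ z ∂μ.singularPart volume, ‖σ z‖ₑ = 1 := by
    have := (Measure.absolutelyContinuous_of_le (Measure.singularPart_le μ volume)).ae_le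
      h.norm_eq_one
    filter_upwards [this] with z hz
    rw [← ofReal_norm, hz, ENNReal.ofReal_one]
  rw [h.integral_eq ψ hψ hψc v, neg_add_eq_sub, ← enorm_neg, neg_sub, hsplit, gradientDefect,
    lintegral_add_measure, lintegral_withDensity_eq_lintegral_mul _ (by fun_prop)
      (by have := hψ.continuous; fun_prop), add_mul]
  refine (enorm_add_le _ _).trans (add_le_add ?_ ?_)
  · refine (enorm_integral_le_lintegral_enorm _).trans ?_
    rw [← lintegral_mul_const' _ _ enorm_ne_top]
    refine lintegral_mono_ae ?_
    filter_upwards [hn1] with z hz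
    simpa [hz] using hin z (σ z)
  · refine (enorm_integral_le_lintegral_enorm _).trans ?_
    rw [← lintegral_mul_const' _ _ enorm_ne_top]
    refine lintegral_mono fun z => ?_
    simp only [Pi.mul_apply]
    rw [mul_comm ‖_ - a‖ₑ]
    exact hin z _

open ContinuousLinearMap in
theorem contDiff_normed_convolution (φ : ContDiffBump (0 : EuclideanSpace ℝ (Fin d)))
    (hu : LocallyIntegrable u volume) :
    ContDiff ℝ 1 (convolution (φ.normed volume) u (lsmul ℝ ℝ) volume) :=
  φ.hasCompactSupport_normed.contDiff_convolution_left _ φ.contDiff_normed hu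

open ContinuousLinearMap in
/-- The gradient of a mollification of `u` is close to `a` up to the mollified defect measure. -/
theorem IsGradientMeasure.enorm_fderiv_convolution_sub_le (h : IsGradientMeasure u μ σ)
    (hu : LocallyIntegrable u volume) (φ : ContDiffBump (0 : EuclideanSpace ℝ (Fin d)))
    (a y : EuclideanSpace ℝ (Fin d)) :
    ‖fderiv ℝ (convolution (φ.normed volume) u (lsmul ℝ ℝ) volume) y - innerSL ℝ a‖ₑ ≤
      ∫⁻ z, ENNReal.ofReal (φ.normed volume (y - z)) ∂gradientDefect μ σ a := by
  refine opENorm_le_bound _ fun v => ?_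
  have hφ : ContDiff ℝ ∞ (φ.normed volume) := φ.contDiff_normed
  have hφ1 : ContDiff ℝ 1 (φ.normed volume) := φ.contDiff_normed
  have hφc : HasCompactSupport (φ.normed volume) := φ.hasCompactSupport_normed
  set ψ : EuclideanSpace ℝ (Fin d) → ℝ := fun z => φ.normed volume (y - z) with hψ
  have hψs : ContDiff ℝ ∞ ψ := hφ.comp (contDiff_const.sub contDiff_id)
  have hψc : HasCompactSupport ψ := hφc.comp_homeomorph (Homeomorph.subLeft y)
  -- The derivative falls on the kernel; the sign comes from the reflection in `ψ z = φ (y - z)`.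
  have h1 : fderiv ℝ (convolution (φ.normed volume) u (lsmul ℝ ℝ) volume) y v =
      -∫ z, u z * fderiv ℝ ψ z v := by
    rw [← convolution_flip, (hφc.hasFDerivAt_convolution_right _ hu hφ1 y).fderiv,
      convolution_precompR_apply _ hu (hφc.fderiv ℝ) (hφ1.continuous_fderiv one_ne_zero),
      convolution_def, ← integral_neg]
    refine integral_congr_ae (Eventually.of_forall fun z => ?_)
    have h2 : HasFDerivAt ψ ((fderiv ℝ (φ.normed volume) (y - z)).comp
        (-ContinuousLinearMap.id ℝ _)) z :=
      ((hφ1.differentiable one_ne_zero).differentiableAt.hasFDerivAt).comp z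
        ((hasFDerivAt_id z).const_sub y)
    simp only [h2.fderiv]
    simp [mul_comm]
  have h2 : ∫ z, ψ z * inner ℝ a v = inner ℝ a v := by
    rw [integral_mul_const, hψ, integral_sub_left_eq_self (φ.normed volume) volume y,
      φ.integral_normed, one_mul]
  have := h.enorm_integral_mul_fderiv_add_le hψs hψc (fun z => φ.nonneg_normed _) a v
  rw [h2] at this
  rw [_root_.sub_apply, h1, innerSL_apply_apply, ← enorm_neg]
  rw [neg_sub, sub_neg_eq_add, add_comm]
  exact this

end Defect

/-! ### Density of the defect measure at almost every point -/

section Density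

variable {d : ℕ} {u : EuclideanSpace ℝ (Fin d) → ℝ} {μ : Measure (EuclideanSpace ℝ (Fin d))}
    {σ : EuclideanSpace ℝ (Fin d) → EuclideanSpace ℝ (Fin d)}

theorem IsGradientMeasure.locallyIntegrable_rnDeriv_smul (h : IsGradientMeasure u μ σ) :
    LocallyIntegrable (fun z => (μ.rnDeriv volume z).toReal • σ z) volume := by
  have hlf := h.locallyFinite
  rw [locallyIntegrable_iff]
  intro k hk
  have h1 : IntegrableOn σ k μ := by
    refine (integrableOn_const hk.measure_lt_top.ne (C := (1 : ℝ))).mono'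
      h.measurable.aestronglyMeasurable ?_
    filter_upwards [ae_restrict_of_ae h.norm_eq_one] with z hz using hz.le
  have h2 : IntegrableOn σ k (volume.withDensity (μ.rnDeriv volume)) :=
    h1.mono_measure (Measure.withDensity_rnDeriv_le _ _)
  rw [IntegrableOn, restrict_withDensity hk.measurableSet] at h2
  exact (integrable_withDensity_iff_integrable_smul' (Measure.measurable_rnDeriv _ _)
      (ae_restrict_of_ae (Measure.rnDeriv_lt_top _ _))).1 h2

theorem IsGradientMeasure.gradientDefect_closedBall_lt_top (h : IsGradientMeasure u μ σ)
    (a x : EuclideanSpace ℝ (Fin d)) (t : ℝ) :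
    gradientDefect μ σ a (Metric.closedBall x t) < ⊤ := by
  have hlf := h.locallyFinite
  rw [gradientDefect, Measure.add_apply,
    withDensity_apply _ Metric.isClosed_closedBall.measurableSet]
  refine ENNReal.add_lt_top.2 ⟨?_, ?_⟩
  · exact (Measure.singularPart_le μ volume _).trans_lt measure_closedBall_lt_top
  · exact ((h.locallyIntegrable_rnDeriv_smul.sub (locallyIntegrable_const a)).integrableOn_isCompact
      (isCompact_closedBall x t)).2

/-- At almost every point, the defect measure has density zero. -/
theorem IsGradientMeasure.ae_gradientDefect_closedBall_le (h : IsGradientMeasure u μ σ) :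
    ∀ᵐ x ∂(volume : Measure (EuclideanSpace ℝ (Fin d))), ∀ η : ℝ≥0∞, η ≠ 0 →
      ∃ δ > 0, ∀ t, 0 < t → t ≤ δ →
        gradientDefect μ σ ((μ.rnDeriv volume x).toReal • σ x) (Metric.closedBall x t) ≤
          η * ENNReal.ofReal (t ^ d) := by
  have hlf := h.locallyFinite
  have hlf' : IsLocallyFiniteMeasure (μ.singularPart volume) :=
    Measure.isLocallyFiniteMeasure_of_le (Measure.singularPart_le μ volume)
  -- The singular part has a derivative equal to its own density, which is zero; the other part is
  -- handled by Lebesgue points of `(dμ/dx) σ`.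
  filter_upwards [Besicovitch.ae_tendsto_rnDeriv (μ.singularPart volume) volume,
    Measure.rnDeriv_singularPart μ volume,
    (Besicovitch.vitaliFamily volume).ae_tendsto_lintegral_enorm_sub_div
      h.locallyIntegrable_rnDeriv_smul] with x hx1 hx2 hx3
  have hx3' := hx3.comp (Besicovitch.tendsto_filterAt volume x)
  rw [hx2, Pi.zero_apply] at hx1
  have hx := hx1.add hx3'
  rw [add_zero] at hx
  intro η hη
  set b := volume (Metric.ball (0 : EuclideanSpace ℝ (Fin d)) 1)
  have hb0 : b ≠ 0 := (Metric.measure_ball_pos volume _ one_pos).ne'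
  have hbt : b ≠ ⊤ := measure_ball_lt_top.ne
  have hev := hx.eventually_lt_const (u := η / b) (ENNReal.div_pos hη hbt)
  obtain ⟨δ, hδ, hδ'⟩ := mem_nhdsGT_iff_exists_Ioc_subset.1 hev
  refine ⟨δ, hδ, fun t ht htδ => ?_⟩
  have hlt := hδ' ⟨ht, htδ⟩
  have hvol : volume (Metric.closedBall x t) = ENNReal.ofReal (t ^ d) * b := by
    rw [Measure.addHaar_closedBall _ _ ht.le]
    simp [b]
  simp only [Function.comp_apply] at hlt
  rw [Set.mem_ofPred_eq] at hlt
  replace hlt := hlt.le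
  rw [← ENNReal.add_div, hvol, ENNReal.div_le_iff (by
    refine mul_ne_zero ?_ hb0
    simp only [ne_eq, ENNReal.ofReal_eq_zero, not_le]
    positivity) (ENNReal.mul_ne_top ENNReal.ofReal_ne_top hbt)] at hlt
  rw [gradientDefect, Measure.add_apply,
    withDensity_apply _ Metric.isClosed_closedBall.measurableSet]
  refine hlt.trans_eq ?_
  rw [mul_comm (ENNReal.ofReal _), ← mul_assoc, ENNReal.div_mul_cancel hb0 hbt]

/-- Zero density settles small radii; for `δ < t ≤ 2` the finite mass of the ball of radius `2` is
compared with `δ ^ d`. The range reaches `2` because the weights live on `r ≤ 1` and mollification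
doubles radii. -/
theorem IsGradientMeasure.ae_exists_gradientDefect_closedBall_le (h : IsGradientMeasure u μ σ) :
    ∀ᵐ x ∂(volume : Measure (EuclideanSpace ℝ (Fin d))), ∃ K : ℝ≥0∞, K ≠ ⊤ ∧
      ∀ t, 0 < t → t ≤ 2 →
        gradientDefect μ σ ((μ.rnDeriv volume x).toReal • σ x) (Metric.closedBall x t) ≤
          K * ENNReal.ofReal (t ^ d) := by
  filter_upwards [h.ae_gradientDefect_closedBall_le] with x hx
  obtain ⟨δ, hδ, hδ'⟩ := hx 1 one_ne_zero
  set ν := gradientDefect μ σ ((μ.rnDeriv volume x).toReal • σ x)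
  have hδd : ENNReal.ofReal (δ ^ d) ≠ 0 := by
    simp only [ne_eq, ENNReal.ofReal_eq_zero, not_le]
    positivity
  refine ⟨1 + ν (Metric.closedBall x 2) / ENNReal.ofReal (δ ^ d), ENNReal.add_ne_top.2
    ⟨ENNReal.one_ne_top, (ENNReal.div_lt_top
      (h.gradientDefect_closedBall_lt_top _ _ _).ne hδd).ne⟩, fun t ht ht2 => ?_⟩
  rcases le_or_gt t δ with htδ | htδ
  · refine (hδ' t ht htδ).trans ?_
    gcongr
    exact le_self_add
  · calc ν (Metric.closedBall x t) ≤ ν (Metric.closedBall x 2) :=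
          measure_mono (Metric.closedBall_subset_closedBall ht2)
      _ = ν (Metric.closedBall x 2) / ENNReal.ofReal (δ ^ d) * ENNReal.ofReal (δ ^ d) :=
          (ENNReal.div_mul_cancel hδd ENNReal.ofReal_ne_top).symm
      _ ≤ _ := by
          gcongr
          exact le_add_self

end Density

/-! ### The quantitative estimate for mollifications and for `u` -/

section Estimate

variable {d : ℕ} {u : EuclideanSpace ℝ (Fin d) → ℝ} {μ : Measure (EuclideanSpace ℝ (Fin d))}
    {σ : EuclideanSpace ℝ (Fin d) → EuclideanSpace ℝ (Fin d)}

open ContinuousLinearMap in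
theorem IsGradientMeasure.setLIntegral_enorm_fderiv_convolution_sub_le
    (h : IsGradientMeasure u μ σ) (hu : LocallyIntegrable u volume)
    (φ : ContDiffBump (0 : EuclideanSpace ℝ (Fin d))) (hφ : φ.rOut ≤ 2 * φ.rIn)
    (a x : EuclideanSpace ℝ (Fin d)) {R : ℝ} (hR : φ.rOut ≤ R) {K : ℝ≥0∞}
    (hK : ∀ t, 0 < t → t ≤ 2 * R →
      gradientDefect μ σ a (Metric.closedBall x t) ≤ K * ENNReal.ofReal (t ^ d))
    {s : ℝ} (hs : 0 < s) (hsR : s ≤ R) :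
    ∫⁻ y in Metric.closedBall 0 s,
      ‖fderiv ℝ (fun k => convolution (φ.normed volume) u (lsmul ℝ ℝ) volume (x + k) -
        inner ℝ a k) y‖ₑ ≤ 4 ^ d * K * ENNReal.ofReal (s ^ d) := by
  have hlf := h.locallyFinite
  have hsf : SFinite (gradientDefect μ σ a) := by unfold gradientDefect; infer_instance
  set V := convolution (φ.normed volume) u (lsmul ℝ ℝ) volume
  have hV : ContDiff ℝ 1 V := contDiff_normed_convolution φ hu
  have hf : ∀ y, fderiv ℝ (fun k => V (x + k) - inner ℝ a k) y =
      fderiv ℝ V (x + y) - innerSL ℝ a := by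
    intro y
    have h1 : HasFDerivAt (fun k => V (x + k)) (fderiv ℝ V (x + y)) y :=
      (((hV.differentiable one_ne_zero).differentiableAt.hasFDerivAt).comp y
        ((hasFDerivAt_id y).const_add x))
    exact (h1.sub (innerSL ℝ a).hasFDerivAt).fderiv
  set Φ : EuclideanSpace ℝ (Fin d) → ℝ≥0∞ := fun y =>
    ∫⁻ z, ENNReal.ofReal (φ.normed volume (y - z)) ∂gradientDefect μ σ a
  have hball : Metric.closedBall (0 : EuclideanSpace ℝ (Fin d)) s =
      (fun y => x + y) ⁻¹' Metric.closedBall x s := by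
    ext y
    simp
  calc _ ≤ ∫⁻ y in Metric.closedBall 0 s, Φ (x + y) := by
        refine lintegral_mono fun y => ?_
        rw [hf]
        exact h.enorm_fderiv_convolution_sub_le hu φ a (x + y)
    _ = ∫⁻ y in Metric.closedBall x s, Φ y := by
        rw [hball]
        exact (measurePreserving_add_left volume x).setLIntegral_comp_preimage_emb
          (measurableEmbedding_addLeft x) Φ _
    _ ≤ _ := by
        have := φ.setLIntegral_closedBall_lintegral_normed_le volume hφ (gradientDefect μ σ a)
          (x := x) hR (K := K) (by simpa using hK) hs hsR
        simpa using this

open ContinuousLinearMap in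
-- The factor `8 ^ d` is `4 ^ d` from mollifying the defect times `2 ^ d` from the dyadic shells. No
-- constant on the right depends on the mollifier, so the bound survives the limit.
theorem IsGradientMeasure.lintegral_enorm_convolution_sub_le
    (hd : 1 ≤ d) (h : IsGradientMeasure u μ σ) (hu : LocallyIntegrable u volume)
    (φ : ContDiffBump (0 : EuclideanSpace ℝ (Fin d))) (hφ : φ.rOut ≤ 2 * φ.rIn)
    (a x : EuclideanSpace ℝ (Fin d)) {δ : ℝ} (hδ1 : δ ≤ 1) (hφδ : φ.rOut ≤ δ) {η K : ℝ≥0∞}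
    (hη : ∀ t, 0 < t → t ≤ 2 * δ →
      gradientDefect μ σ a (Metric.closedBall x t) ≤ η * ENNReal.ofReal (t ^ d))
    (hK : ∀ t, 0 < t → t ≤ 2 →
      gradientDefect μ σ a (Metric.closedBall x t) ≤ K * ENNReal.ofReal (t ^ d))
    {w : ℝ → ℝ≥0∞} (hw : Measurable w) (hw1 : ∀ᵐ r ∂volume.restrict (Ioi (1 : ℝ)), w r = 0) :
    ∫⁻ k, ‖convolution (φ.normed volume) u (lsmul ℝ ℝ) volume (x + k) -
        convolution (φ.normed volume) u (lsmul ℝ ℝ) volume x - inner ℝ a k‖ₑ / ‖k‖ₑ * w ‖k‖ ≤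
      8 ^ d * (η * (∫⁻ r in Ioi (0 : ℝ), w r * ENNReal.ofReal (r ^ (d - 1))) +
        K * ∫⁻ r in Ioi δ, w r * ENNReal.ofReal (r ^ (d - 1))) := by
  have hne : Nonempty (Fin d) := ⟨⟨0, hd⟩⟩
  set V := convolution (φ.normed volume) u (lsmul ℝ ℝ) volume
  have hV : ContDiff ℝ 1 V := contDiff_normed_convolution φ hu
  set U : EuclideanSpace ℝ (Fin d) → ℝ := fun k => V (x + k) - inner ℝ a k
  have hU : ContDiff ℝ 1 U :=
    (hV.comp (contDiff_const.add contDiff_id)).sub (contDiff_const.inner ℝ contDiff_id)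
  have hδ : 0 < δ := φ.rOut_pos.trans_le hφδ
  -- The value `⊤` beyond radius `1` makes the growth hypothesis trivial there, and it is harmless
  -- because `w` vanishes almost everywhere on that range and `⊤ * 0 = 0`.
  set B : ℝ → ℝ≥0∞ := fun r => if r ≤ δ then 4 ^ d * η else if r ≤ 1 then 4 ^ d * K else ⊤
  have hB : ∀ r s, 0 < s → s ≤ r → ∫⁻ y in Metric.closedBall 0 s, ‖fderiv ℝ U y‖ₑ ≤
      B r * ENNReal.ofReal (s ^ Module.finrank ℝ (EuclideanSpace ℝ (Fin d))) := by
    intro r s hs hsr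
    rw [finrank_euclideanSpace_fin]
    simp only [B]
    split_ifs with h1 h2
    · exact h.setLIntegral_enorm_fderiv_convolution_sub_le hu φ hφ a x hφδ hη hs (hsr.trans h1)
    · exact h.setLIntegral_enorm_fderiv_convolution_sub_le hu φ hφ a x (hφδ.trans hδ1)
        (by simpa using hK) hs (hsr.trans h2)
    · rw [ENNReal.top_mul]
      · exact le_top
      · simp only [ne_eq, ENNReal.ofReal_eq_zero, not_le]
        positivity
  have key := lintegral_enorm_sub_div_mul_le volume hU hw hB
  rw [finrank_euclideanSpace_fin] at key
  have hU0 : ∀ k, U k - U 0 = V (x + k) - V x - inner ℝ a k := by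
    intro k
    simp only [U, add_zero, inner_zero_right]
    ring
  simp only [hU0] at key
  refine key.trans ?_
  have h8 : (8 : ℝ≥0∞) ^ d = 2 ^ d * 4 ^ d := by rw [← mul_pow]; norm_num
  have hw1' : ∀ᵐ r ∂volume, r ∈ Ioi (1 : ℝ) → w r = 0 :=
    (ae_restrict_iff' measurableSet_Ioi).1 hw1
  have hm : Measurable fun r => w r * ENNReal.ofReal (r ^ (d - 1)) := by fun_prop
  rw [← lintegral_const_mul _ hm, ← lintegral_const_mul _ hm,
    ← lintegral_indicator measurableSet_Ioi, ← lintegral_indicator measurableSet_Ioi,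
    ← lintegral_indicator measurableSet_Ioi,
    ← lintegral_add_left ((hm.const_mul η).indicator measurableSet_Ioi),
    ← lintegral_const_mul' _ _ (ENNReal.pow_ne_top (by norm_num))]
  refine lintegral_mono_ae ?_
  filter_upwards [hw1'] with r hr
  by_cases h0 : r ∈ Ioi (0 : ℝ)
  swap
  · rw [indicator_of_notMem h0]; exact zero_le
  rw [indicator_of_mem h0, indicator_of_mem h0]
  by_cases h1 : r ≤ δ
  · have : B r = 4 ^ d * η := if_pos h1
    rw [this, h8]
    calc _ = 2 ^ d * 4 ^ d * (η * (w r * ENNReal.ofReal (r ^ (d - 1)))) := by ring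
      _ ≤ _ := by gcongr; exact le_self_add
  · rw [indicator_of_mem (show r ∈ Ioi δ from not_le.1 h1)]
    by_cases h2 : r ≤ 1
    · have : B r = 4 ^ d * K := by simp only [B, if_neg h1, if_pos h2]
      rw [this, h8]
      calc _ = 2 ^ d * 4 ^ d * (K * (w r * ENNReal.ofReal (r ^ (d - 1)))) := by ring
        _ ≤ _ := by gcongr; exact le_add_self
    · rw [hr (not_le.1 h2)]
      simp

/-- Fatou's lemma along bumps shrinking to a point, at any `x` where the mollifications converge to
`u x`. The exceptional null set is fixed before `a`, so `a` may later depend on `x`, and before `w`,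
so it serves all `n` at once. -/
theorem IsGradientMeasure.ae_lintegral_enorm_sub_sub_inner_le
    (hd : 1 ≤ d) (h : IsGradientMeasure u μ σ) (hu : LocallyIntegrable u volume) :
    ∀ᵐ x ∂(volume : Measure (EuclideanSpace ℝ (Fin d))), ∀ (a : EuclideanSpace ℝ (Fin d))
      (δ : ℝ) (η K : ℝ≥0∞) (w : ℝ → ℝ≥0∞), 0 < δ → δ ≤ 1 →
      (∀ t, 0 < t → t ≤ 2 * δ →
        gradientDefect μ σ a (Metric.closedBall x t) ≤ η * ENNReal.ofReal (t ^ d)) →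
      (∀ t, 0 < t → t ≤ 2 →
        gradientDefect μ σ a (Metric.closedBall x t) ≤ K * ENNReal.ofReal (t ^ d)) →
      Measurable w → (∀ᵐ r ∂volume.restrict (Ioi (1 : ℝ)), w r = 0) →
      ∫⁻ k, ‖u (x + k) - u x - inner ℝ a k‖ₑ / ‖k‖ₑ * w ‖k‖ ≤
        8 ^ d * (η * (∫⁻ r in Ioi (0 : ℝ), w r * ENNReal.ofReal (r ^ (d - 1))) +
          K * ∫⁻ r in Ioi δ, w r * ENNReal.ofReal (r ^ (d - 1))) := by
  let φ : ℕ → ContDiffBump (0 : EuclideanSpace ℝ (Fin d)) := fun i =>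
    ⟨1 / 2 * (1 / ((i : ℝ) + 1)), 1 / ((i : ℝ) + 1), by positivity,
      by have : 0 < 1 / ((i : ℝ) + 1) := by positivity
         linarith⟩
  have hφ0 : Tendsto (fun i => (φ i).rOut) atTop (𝓝 0) := tendsto_one_div_add_atTop_nhds_zero_nat
  have hφ2 : ∀ i, (φ i).rOut ≤ 2 * (φ i).rIn := fun i => by simp [φ]
  have hconv := ContDiffBump.ae_convolution_tendsto_right_of_locallyIntegrable hφ0
    (Eventually.of_forall hφ2) hu
  filter_upwards [hconv] with x hx a δ η K w hδ hδ1 hη hK hw hw1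
  set V : ℕ → EuclideanSpace ℝ (Fin d) → ℝ := fun i =>
    convolution ((φ i).normed volume) u (ContinuousLinearMap.lsmul ℝ ℝ) volume
  have hVc : ∀ i, Continuous (V i) := fun i => (contDiff_normed_convolution (φ i) hu).continuous
  have hconv' : ∀ᵐ k, Tendsto (fun i => V i (x + k)) atTop (𝓝 (u (x + k))) :=
    (measurePreserving_add_left volume x).quasiMeasurePreserving.ae hconv
  have hle : ∀ᶠ i in atTop, ∫⁻ k, ‖V i (x + k) - V i x - inner ℝ a k‖ₑ / ‖k‖ₑ * w ‖k‖ ≤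
        8 ^ d * (η * (∫⁻ r in Ioi (0 : ℝ), w r * ENNReal.ofReal (r ^ (d - 1))) +
          K * ∫⁻ r in Ioi δ, w r * ENNReal.ofReal (r ^ (d - 1))) := by
    filter_upwards [hφ0.eventually_le_const hδ] with i hi
    exact h.lintegral_enorm_convolution_sub_le hd hu (φ i) (hφ2 i) a x hδ1 hi hη hK hw hw1
  calc ∫⁻ k, ‖u (x + k) - u x - inner ℝ a k‖ₑ / ‖k‖ₑ * w ‖k‖
      ≤ ∫⁻ k, liminf (fun i => ‖V i (x + k) - V i x - inner ℝ a k‖ₑ / ‖k‖ₑ * w ‖k‖) atTop := by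
        refine lintegral_mono_ae ?_
        filter_upwards [hconv'] with k hk
        have h1 := ((((hk.sub hx).sub_const (inner ℝ a k)).enorm).liminf_eq)
        simp only [div_eq_mul_inv, mul_assoc]
        -- The factor `‖k‖ₑ⁻¹ * w ‖k‖` may be `⊤`, where multiplication is not continuous; the
        -- one-sided inequality for the `liminf` is enough.
        refine le_trans (le_of_eq ?_) (ENNReal.le_liminf_mul (f := atTop)
          (u := fun i => ‖V i (x + k) - V i x - inner ℝ a k‖ₑ) (v := fun _ => ‖k‖ₑ⁻¹ * w ‖k‖))
        rw [liminf_const, h1]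
    _ ≤ liminf (fun i => ∫⁻ k, ‖V i (x + k) - V i x - inner ℝ a k‖ₑ / ‖k‖ₑ * w ‖k‖) atTop := by
        refine lintegral_liminf_le fun i => ?_
        have := hVc i
        fun_prop
    _ ≤ _ := liminf_le_of_frequently_le' hle.frequently

end Estimate

/-! ### Borel representatives of the radial weights -/

theorem IsRadialMollifierSeq.exists_measurable_density {d : ℕ} {ρ : ℕ → ℝ → ℝ}
    (hρ : IsRadialMollifierSeq d ρ) (n : ℕ) :
    ∃ w : ℝ → ℝ≥0∞, Measurable w ∧
      (∀ᵐ r ∂volume.restrict (Ioi (0 : ℝ)), ENNReal.ofReal (ρ n r) = w r) ∧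
      (∀ᵐ r ∂volume.restrict (Ioi (1 : ℝ)), w r = 0) ∧
      ∫⁻ r in Ioi (0 : ℝ), w r * ENNReal.ofReal (r ^ (d - 1)) = 1 ∧
      ∀ δ, 0 ≤ δ → ∫⁻ r in Ioi δ, w r * ENNReal.ofReal (r ^ (d - 1)) =
        ENNReal.ofReal (∫ r in Ioi δ, ρ n r * r ^ (d - 1)) := by
  have hm : AEMeasurable (fun r => ENNReal.ofReal (ρ n r)) (volume.restrict (Ioi 0)) :=
    (hρ.locallyIntegrable n).aestronglyMeasurable.aemeasurable.ennreal_ofReal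
  have hae : ∀ᵐ r ∂volume.restrict (Ioi (0 : ℝ)), ENNReal.ofReal (ρ n r) = hm.mk _ r :=
    hm.ae_eq_mk
  -- A nonintegrable function would have integral `0` by convention, not `1`.
  have hint : Integrable (fun r => ρ n r * r ^ (d - 1)) (volume.restrict (Ioi 0)) :=
    integrable_of_integral_eq_one (hρ.integral_eq_one n)
  have htail : ∀ δ, 0 ≤ δ → ∫⁻ r in Ioi δ, hm.mk _ r * ENNReal.ofReal (r ^ (d - 1)) =
      ENNReal.ofReal (∫ r in Ioi δ, ρ n r * r ^ (d - 1)) := by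
    intro δ hδ
    have hsub : Ioi δ ⊆ Ioi (0 : ℝ) := Ioi_subset_Ioi hδ
    have hle := ae_mono (Measure.restrict_mono_set (volume : Measure ℝ) hsub)
    rw [ofReal_integral_eq_lintegral_ofReal (hint.mono_measure
      (Measure.restrict_mono_set _ hsub))]
    · refine lintegral_congr_ae ?_
      filter_upwards [hle hae, hle (hρ.nonneg n)] with r hr hr0
      rw [← hr, ENNReal.ofReal_mul hr0]
    · filter_upwards [hle (hρ.nonneg n), ae_restrict_mem measurableSet_Ioi] with r hr hr0
      exact mul_nonneg hr (pow_nonneg (hδ.trans hr0.le) _)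
  refine ⟨hm.mk _, hm.measurable_mk, hae, ?_, ?_, htail⟩
  · filter_upwards [hρ.eq_zero n, ae_mono (Measure.restrict_mono_set (volume : Measure ℝ)
      (Ioi_subset_Ioi zero_le_one)) hae] with r hr hr'
    rw [← hr', hr, ENNReal.ofReal_zero]
  · rw [htail 0 le_rfl, hρ.integral_eq_one, ENNReal.ofReal_one]

section Norm

variable {E : Type*} [NormedAddCommGroup E] [NormedSpace ℝ E] [FiniteDimensional ℝ E]
  [MeasurableSpace E] [BorelSpace E] [Nontrivial E] (μ : Measure E) [μ.IsAddHaarMeasure]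

/-- By polar coordinates, a null set of radii sweeps out a null set of vectors. This allows `ρ n
‖h‖` to be replaced by its Borel representative. -/
theorem ae_norm_of_ae_restrict_Ioi {P : ℝ → Prop}
    (hP : ∀ᵐ r ∂volume.restrict (Ioi (0 : ℝ)), P r) : ∀ᵐ h ∂μ, P ‖h‖ := by
  obtain ⟨N, hN, hNm, hN0⟩ := exists_measurable_superset_of_null (ae_iff.1 hP)
  have hN1 : ∀ᵐ r ∂volume.restrict (Ioi (0 : ℝ)), r ∉ N := measure_eq_zero_iff_ae_notMem.1 hN0
  have hm : Measurable fun h : E => N.indicator (1 : ℝ → ℝ≥0∞) ‖h‖ :=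
    (measurable_one.indicator hNm).comp measurable_norm
  have h0 : ∫⁻ h, N.indicator 1 ‖h‖ ∂μ = (0 : ℝ≥0∞) := by
    rw [lintegral_eq_lintegral_lintegral_sphere μ hm,
      ← lintegral_zero (μ := volume.restrict (Ioi (0 : ℝ)))]
    refine lintegral_congr_ae ?_
    filter_upwards [hN1, ae_restrict_mem measurableSet_Ioi] with r hr (hr0 : 0 < r)
    have : ∀ s : Metric.sphere (0 : E) 1, N.indicator (1 : ℝ → ℝ≥0∞) ‖r • (s : E)‖ = 0 := by
      intro s
      rw [norm_smul, norm_eq_of_mem_sphere, mul_one, Real.norm_of_nonneg hr0.le,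
        indicator_of_notMem hr]
    simp [this]
  filter_upwards [(lintegral_eq_zero_iff hm).1 h0] with h hh
  by_contra hc
  simp [indicator_of_mem (hN hc)] at hh

end Norm

/-! ### Spherical averages of linear functions -/

section Inner

variable {E : Type*} [NormedAddCommGroup E] [InnerProductSpace ℝ E] [FiniteDimensional ℝ E]
  [MeasurableSpace E] [BorelSpace E] [Nontrivial E]

theorem lintegral_enorm_inner_div_mul (μ : Measure E) [μ.IsAddHaarMeasure] (a : E)
    {w : ℝ → ℝ≥0∞} (hw : Measurable w) :
    ∫⁻ h, ‖inner ℝ a h‖ₑ / ‖h‖ₑ * w ‖h‖ ∂μ =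
      (∫⁻ r in Ioi (0 : ℝ), w r * ENNReal.ofReal (r ^ (Module.finrank ℝ E - 1))) *
        ∫⁻ s : Metric.sphere (0 : E) 1, ‖inner ℝ a (s : E)‖ₑ ∂μ.toSphere := by
  rw [lintegral_eq_lintegral_lintegral_sphere μ (by fun_prop),
    ← lintegral_mul_const _ (by fun_prop)]
  refine setLIntegral_congr_fun measurableSet_Ioi fun r (hr : 0 < r) => ?_
  have : ∀ s : Metric.sphere (0 : E) 1, ‖inner ℝ a (r • (s : E))‖ₑ / ‖r • (s : E)‖ₑ *
      w ‖r • (s : E)‖ = w r * ‖inner ℝ a (s : E)‖ₑ := by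
    intro s
    have h1 : ‖r • (s : E)‖ = r := by
      rw [norm_smul, norm_eq_of_mem_sphere, mul_one, Real.norm_of_nonneg hr.le]
    have h2 : ‖r • (s : E)‖ₑ = ENNReal.ofReal r := by rw [← ofReal_norm, h1]
    rw [h1, h2, inner_smul_right, enorm_mul, Real.enorm_of_nonneg hr.le, mul_comm (w r),
      mul_comm (ENNReal.ofReal r), ENNReal.mul_div_cancel_right (by simpa using hr)
        ENNReal.ofReal_ne_top]
  simp only [this]
  rw [lintegral_const_mul _ (by fun_prop)]
  ring

/-- Rotation invariance on the sphere is deduced from that of Lebesgue measure: a radial weight of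
unit mass writes the spherical integral as a volume integral, and the reflection exchanging `a` and
`b` preserves volume. Applied to `a` and `‖a‖ • e`, it makes the choice of unit vector in `gammaOne`
irrelevant. -/
theorem lintegral_sphere_enorm_inner_eq_of_norm_eq {a b : E} (hab : ‖a‖ = ‖b‖) :
    ∫⁻ s : Metric.sphere (0 : E) 1, ‖inner ℝ a (s : E)‖ₑ ∂(volume : Measure E).toSphere =
      ∫⁻ s : Metric.sphere (0 : E) 1, ‖inner ℝ b (s : E)‖ₑ ∂(volume : Measure E).toSphere := by
  set w : ℝ → ℝ≥0∞ := (Ioo (0 : ℝ) 1).indicator fun r =>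
    (ENNReal.ofReal (r ^ (Module.finrank ℝ E - 1)))⁻¹
  have hw : Measurable w := Measurable.indicator (by fun_prop) measurableSet_Ioo
  have hw1 : ∫⁻ r in Ioi (0 : ℝ), w r * ENNReal.ofReal (r ^ (Module.finrank ℝ E - 1)) = 1 := by
    have h1 : ∀ r, w r * ENNReal.ofReal (r ^ (Module.finrank ℝ E - 1)) =
        (Ioo (0 : ℝ) 1).indicator 1 r := by
      intro r
      by_cases hr : r ∈ Ioo (0 : ℝ) 1
      · simp only [w, indicator_of_mem hr, Pi.one_apply]
        refine ENNReal.inv_mul_cancel ?_ ENNReal.ofReal_ne_top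
        have := pow_pos hr.1 (Module.finrank ℝ E - 1)
        simpa using this
      · simp [w, indicator_of_notMem hr]
    simp only [h1]
    rw [lintegral_indicator_one measurableSet_Ioo, Measure.restrict_apply measurableSet_Ioo,
      inter_eq_left.2 Ioo_subset_Ioi_self]
    simp
  have key : ∀ c : E, ∫⁻ h, ‖inner ℝ c h‖ₑ / ‖h‖ₑ * w ‖h‖ =
      ∫⁻ s : Metric.sphere (0 : E) 1, ‖inner ℝ c (s : E)‖ₑ ∂(volume : Measure E).toSphere := by
    intro c
    rw [lintegral_enorm_inner_div_mul volume c hw, hw1, one_mul]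
  rw [← key, ← key]
  set R : E ≃ₗᵢ[ℝ] E := (ℝ ∙ (a - b))ᗮ.reflection
  have hR : R a = b := Submodule.reflection_sub hab
  rw [← R.measurePreserving.lintegral_comp_emb R.toHomeomorph.measurableEmbedding
    (fun h => ‖inner ℝ b h‖ₑ / ‖h‖ₑ * w ‖h‖)]
  refine lintegral_congr fun h => ?_
  have h2 : ‖R h‖ₑ = ‖h‖ₑ := by rw [← ofReal_norm, ← ofReal_norm, R.norm_map]
  rw [h2, R.norm_map, ← hR, R.inner_map_map]

end Inner

theorem ofReal_gammaOne {d : ℕ} (e : EuclideanSpace ℝ (Fin d)) :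
    ENNReal.ofReal (gammaOne e) =
      ∫⁻ s : Metric.sphere (0 : EuclideanSpace ℝ (Fin d)) 1,
        ‖inner ℝ e (s : EuclideanSpace ℝ (Fin d))‖ₑ
        ∂(volume : Measure (EuclideanSpace ℝ (Fin d))).toSphere := by
  rw [gammaOne, ofReal_integral_eq_lintegral_ofReal _ (Eventually.of_forall fun s => abs_nonneg _)]
  · refine lintegral_congr fun s => ?_
    rw [real_inner_comm, ← Real.norm_eq_abs, ofReal_norm]
  · refine Continuous.integrable_of_hasCompactSupport (by fun_prop) ?_
    exact HasCompactSupport.of_compactSpace _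

theorem ae_ofReal_div_mul_eq {d : ℕ} (hd : 1 ≤ d) {r : ℝ → ℝ} {w : ℝ → ℝ≥0∞}
    (hr : ∀ᵐ t ∂volume.restrict (Ioi (0 : ℝ)), ENNReal.ofReal (r t) = w t)
    (F : EuclideanSpace ℝ (Fin d) → ℝ) :
    ∀ᵐ h : EuclideanSpace ℝ (Fin d), ENNReal.ofReal (|F h| / ‖h‖ * r ‖h‖) =
      ‖F h‖ₑ / ‖h‖ₑ * w ‖h‖ := by
  have hne : Nonempty (Fin d) := ⟨⟨0, hd⟩⟩
  filter_upwards [ae_norm_of_ae_restrict_Ioi volume hr,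
    measure_eq_zero_iff_ae_notMem.1 (measure_singleton (0 : EuclideanSpace ℝ (Fin d)))] with h h1 h2
  rw [ENNReal.ofReal_mul (by positivity), h1, ENNReal.ofReal_div_of_pos (norm_pos_iff.2 h2),
    ← Real.norm_eq_abs, ofReal_norm, ofReal_norm]

theorem ENNReal.tendsto_of_le_add_of_le_add {D ε : ℕ → ℝ≥0∞} {L : ℝ≥0∞} (hL : L ≠ ⊤)
    (hε : Tendsto ε atTop (𝓝 0)) (h1 : ∀ n, D n ≤ ε n + L) (h2 : ∀ n, L ≤ ε n + D n) :
    Tendsto D atTop (𝓝 L) := by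
  refine tendsto_of_tendsto_of_tendsto_of_le_of_le (g := fun n => L - ε n)
    (h := fun n => ε n + L) ?_ ?_ (fun n => tsub_le_iff_left.2 (h2 n)) h1
  · simpa using ENNReal.Tendsto.sub (tendsto_const_nhds (x := L)) hε (Or.inl hL)
  · simpa using hε.add_const L

/-! ### The two limits -/

theorem IsRadialMollifierSeq.ae_tendsto_lintegral_sub_sub_inner {d : ℕ} (hd : 1 ≤ d)
    {ρ : ℕ → ℝ → ℝ} (hρ : IsRadialMollifierSeq d ρ) {u : EuclideanSpace ℝ (Fin d) → ℝ}
    (hu : LocallyIntegrable u volume)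
    {g : EuclideanSpace ℝ (Fin d) → EuclideanSpace ℝ (Fin d)} (hg : IsACGradient u g) :
    ∀ᵐ x ∂(volume : Measure (EuclideanSpace ℝ (Fin d))),
      Tendsto (fun n => ∫⁻ h : EuclideanSpace ℝ (Fin d),
          ENNReal.ofReal (|u (x + h) - u x - inner ℝ (g x) h| / ‖h‖ * ρ n ‖h‖))
        atTop (𝓝 0) := by
  obtain ⟨μ, σ, h, hgσ⟩ := hg
  choose w hw hwρ hw1 hwint hwtail using hρ.exists_measurable_density
  filter_upwards [hgσ, h.ae_gradientDefect_closedBall_le, h.ae_exists_gradientDefect_closedBall_le,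
    h.ae_lintegral_enorm_sub_sub_inner_le hd hu] with x hx hη ⟨K, hKt, hK⟩ hest
  rw [← hx] at hη hK
  have htail : ∀ δ, 0 < δ →
      Tendsto (fun n => ∫⁻ r in Ioi δ, w n r * ENNReal.ofReal (r ^ (d - 1))) atTop (𝓝 0) := by
    intro δ hδ
    simp only [fun n => hwtail n δ hδ.le]
    simpa using ENNReal.tendsto_ofReal (hρ.tendsto_tail δ hδ)
  have h8 : (8 : ℝ≥0∞) ^ d ≠ ⊤ := ENNReal.pow_ne_top (by norm_num)
  have h80 : (8 : ℝ≥0∞) ^ d ≠ 0 := pow_ne_zero _ (by norm_num)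
  rw [ENNReal.tendsto_nhds_zero]
  intro ε hε
  -- The near part then contributes exactly `ε / 2`, because the weight has mass one.
  set η : ℝ≥0∞ := ε / 2 / 8 ^ d
  have hη0 : η ≠ 0 := (ENNReal.div_pos (ENNReal.half_pos hε.ne').ne' h8).ne'
  obtain ⟨δ₀, hδ₀, hδ⟩ := hη η hη0
  -- Halving is needed since the estimate up to radius `δ` uses the defect up to `2 * δ`.
  set δ := min (δ₀ / 2) 1
  have hδpos : 0 < δ := by positivity
  have hlim : Tendsto (fun n => 8 ^ d * (K * ∫⁻ r in Ioi δ, w n r * ENNReal.ofReal (r ^ (d - 1))))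
      atTop (𝓝 0) := by
    have h1 := ENNReal.Tendsto.const_mul (htail δ hδpos) (Or.inr hKt)
    rw [mul_zero] at h1
    have h2 := ENNReal.Tendsto.const_mul h1 (Or.inr h8)
    rwa [mul_zero] at h2
  filter_upwards [(ENNReal.tendsto_nhds_zero.1 hlim) (ε / 2) (ENNReal.half_pos hε.ne')] with n hn
  rw [lintegral_congr_ae (ae_ofReal_div_mul_eq hd (hwρ n)
    fun k => u (x + k) - u x - inner ℝ (g x) k)]
  refine (hest (g x) δ η K (w n) hδpos (min_le_right _ _)
    (fun t ht htδ => hδ t ht (htδ.trans ?_)) hK (hw n) (hw1 n)).trans ?_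
  · linarith [min_le_left (δ₀ / 2) 1]
  · rw [hwint, mul_one, mul_add, ENNReal.mul_div_cancel h80 h8]
    exact (add_le_add_right hn _).trans_eq (ENNReal.add_halves ε)

/-- The linear function `k ↦ a · k` has the same weighted integral for every `n`, by homogeneity and
the unit mass of the weight. The triangle inequality in both directions bounds the discrepancy by
the first-order remainder; being phrased without subtraction, it also covers infinite values of
`nonlocalD`. -/
theorem IsRadialMollifierSeq.tendsto_nonlocalD {d : ℕ} (hd : 1 ≤ d)
    {ρ : ℕ → ℝ → ℝ} (hρ : IsRadialMollifierSeq d ρ) {u : EuclideanSpace ℝ (Fin d) → ℝ}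
    (hu : AEMeasurable u) {x a e : EuclideanSpace ℝ (Fin d)} (he : ‖e‖ = 1)
    (h : Tendsto (fun n => ∫⁻ h : EuclideanSpace ℝ (Fin d),
          ENNReal.ofReal (|u (x + h) - u x - inner ℝ a h| / ‖h‖ * ρ n ‖h‖)) atTop (𝓝 0)) :
    Tendsto (fun n => nonlocalD (ρ n) u x) atTop (𝓝 (ENNReal.ofReal (gammaOne e * ‖a‖))) := by
  have hne : Nonempty (Fin d) := ⟨⟨0, hd⟩⟩
  choose w hw hwρ hw1 hwint hwtail using hρ.exists_measurable_density
  have hL : ∀ n, ∫⁻ k : EuclideanSpace ℝ (Fin d), ‖inner ℝ a k‖ₑ / ‖k‖ₑ * w n ‖k‖ =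
      ENNReal.ofReal (gammaOne e * ‖a‖) := by
    intro n
    rw [lintegral_enorm_inner_div_mul volume a (hw n), finrank_euclideanSpace_fin, hwint, one_mul,
      lintegral_sphere_enorm_inner_eq_of_norm_eq (b := ‖a‖ • e) (by simp [norm_smul, he]),
      mul_comm, ENNReal.ofReal_mul (norm_nonneg _), ofReal_gammaOne, ofReal_norm,
      ← lintegral_const_mul' _ _ enorm_ne_top]
    refine lintegral_congr fun s => ?_
    rw [real_inner_smul_left, enorm_mul, enorm_norm]
  have hD : ∀ n, nonlocalD (ρ n) u x = ∫⁻ k, ‖u (x + k) - u x‖ₑ / ‖k‖ₑ * w n ‖k‖ := by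
    intro n
    rw [nonlocalD, ← lintegral_add_left_eq_self _ x, ← lintegral_congr_ae
      (ae_ofReal_div_mul_eq hd (hwρ n) fun k => u (x + k) - u x)]
    refine lintegral_congr fun k => ?_
    rw [abs_sub_comm, sub_add_cancel_left, norm_neg]
  have hE : ∀ n, ∫⁻ k : EuclideanSpace ℝ (Fin d),
      ENNReal.ofReal (|u (x + k) - u x - inner ℝ a k| / ‖k‖ * ρ n ‖k‖) =
      ∫⁻ k, ‖u (x + k) - u x - inner ℝ a k‖ₑ / ‖k‖ₑ * w n ‖k‖ := fun n =>
    lintegral_congr_ae (ae_ofReal_div_mul_eq hd (hwρ n) fun k => u (x + k) - u x - inner ℝ a k)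
  simp only [hE] at h
  refine ENNReal.tendsto_of_le_add_of_le_add ENNReal.ofReal_ne_top h (fun n => ?_) (fun n => ?_)
  · have := hw n
    rw [← hL n, hD, ← lintegral_add_right _ (by fun_prop)]
    refine lintegral_mono fun k => ?_
    simp only [← add_mul, ← ENNReal.add_div]
    gcongr
    simpa using enorm_add_le (u (x + k) - u x - inner ℝ a k) (inner ℝ a k)
  · have hux : AEMeasurable (fun k => u (x + k)) :=
      hu.comp_quasiMeasurePreserving (measurePreserving_add_left volume x).quasiMeasurePreserving
    have := hw n
    rw [← hL n, hD, ← lintegral_add_right' _ (by fun_prop)]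
    refine lintegral_mono fun k => ?_
    simp only [← add_mul, ← ENNReal.add_div]
    gcongr
    rw [add_comm]
    simpa using enorm_sub_le (a := u (x + k) - u x) (b := u (x + k) - u x - inner ℝ a k)

theorem mainTheorem3 (d : ℕ) (hd : 1 ≤ d) (ρ : ℕ → ℝ → ℝ) (hρ : IsRadialMollifierSeq d ρ)
    (u : EuclideanSpace ℝ (Fin d) → ℝ) (hu : MemBVloc u)
    (g : EuclideanSpace ℝ (Fin d) → EuclideanSpace ℝ (Fin d)) (hg : IsACGradient u g) :
    (∀ᵐ x ∂(volume : Measure (EuclideanSpace ℝ (Fin d))),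
      Tendsto (fun n => ∫⁻ h : EuclideanSpace ℝ (Fin d),
          ENNReal.ofReal (|u (x + h) - u x - inner ℝ (g x) h| / ‖h‖ * ρ n ‖h‖))
        atTop (𝓝 0)) ∧
    (∀ e : EuclideanSpace ℝ (Fin d), ‖e‖ = 1 →
      ∀ᵐ x ∂(volume : Measure (EuclideanSpace ℝ (Fin d))),
        Tendsto (fun n => nonlocalD (ρ n) u x) atTop
          (𝓝 (ENNReal.ofReal (gammaOne e * ‖g x‖)))) := by
  have h := hρ.ae_tendsto_lintegral_sub_sub_inner hd hu.1 hg
  exact ⟨h, fun e he => h.mono fun x hx =>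
    hρ.tendsto_nonlocalD hd hu.1.aestronglyMeasurable.aemeasurable he hx⟩
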